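/- Let $\Omega\subset\mathbb R^2$ be open, bounded and connected, let $x_{\min}=\inf_{(x,y)\in\Omega}x$, and assume that there is a unique point $A_0\in\partial\Omega$ whose first coordinate is $x_{\min}$, and that $\partial\Omega$ is smooth near $A_0$. Let $\gamma:(-r,r)\to\partial\Omega$ be a smooth counterclockwise arc-length parametrization of $\partial\Omega$ near $A_0=\gamma(0)$, let $\boldsymbol n(s)=(\gamma_2'(s),-\gamma_1'(s))$ be the outward unit normal at $\gamma(s)$, define the curvature $\kappa$ by $\gamma''(s)=-\kappa(s)\boldsymbol n(s)$, and assume $\kappa(0)>0$. For $\delta>0$ let $\mathcal W_\delta=(-\delta,\delta)\times(0,\delta)$, and set $$\boldsymbol\tau(s,t)=(\tau_1,\tau_2)(s,t)=\gamma(s)-t\,\boldsymbol n(s),\qquad m(s,t)=1-\kappa(s)t .$$ For $h>0$ let $\mathscr M_h$ be the Dirichlet realization of $$-h^2m^{-1}\partial_s m^{-1}\partial_s-h^2m^{-1}\partial_t m\,\partial_t+\tau_1(s,t)$$ on $L^2(\mathcal W_\delta;\,m\,ds\,dt)$, i.e. the self-adjoint operator associated with the quadratic form $\int_{\mathcal W_\delta}\big(m^{-2}|h\partial_s\psi|^2+|h\partial_t\psi|^2+\tau_1|\psi|^2\big)\,m\,ds\,dt$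 on $H^1_0(\mathcal W_\delta)$, and let $\|\cdot\|$ be the norm of $L^2(\mathcal W_\delta;\,m\,ds\,dt)$. Then for every sufficiently small $\delta>0$ the following holds. For every $M>0$ there exist $\varepsilon,C,h_0>0$ such that for all $h\in(0,h_0)$ and every eigenfunction $\psi$ of $\mathscr M_h$ with an eigenvalue $\lambda\le x_{\min}+Mh^{2/3}$, $$\int_{\mathcal W_\delta}e^{\varepsilon t^{3/2}/h}|\psi|^2\,ds\,dt\le C\|\psi\|^2,\qquad \int_{\mathcal W_\delta}e^{\varepsilon t^{3/2}/h}|h\nabla_{s,t}\psi|^2\,ds\,dt\le C h^{2/3}\|\psi\|^2 .$$ -/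

import Mathlib

open MeasureTheory Set Filter Topology
open scoped ContDiff ComplexConjugate

namespace Stark

noncomputable section

/-- The infimum of the first coordinate over `Ω`. -/
def xMin (Ω : Set (ℝ × ℝ)) : ℝ := sInf (Prod.fst '' Ω)

/-- The boundary of `Ω` is smooth near `A`: in a neighbourhood of `A`, `Ω` is the negativity set
of a smooth function without critical points. -/
def SmoothBoundaryNear (Ω : Set (ℝ × ℝ)) (A : ℝ × ℝ) : Prop :=
  ∃ (U : Set (ℝ × ℝ)) (ρ : ℝ × ℝ → ℝ), IsOpen U ∧ A ∈ U ∧ ContDiffOn ℝ ∞ ρ U ∧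
    (∀ p ∈ U, fderiv ℝ ρ p ≠ 0) ∧ Ω ∩ U = {p | ρ p < 0} ∩ U

/-- Bounded, open, connected planar sets whose boundary has exactly one point `A₀` of
smallest first coordinate, and is smooth near that point. (The positivity of the curvature at `A₀`
is a separate condition, see `curvature`.) -/
structure IsStarkDomain (Ω : Set (ℝ × ℝ)) (A₀ : ℝ × ℝ) : Prop where
  isOpen : IsOpen Ω
  isBounded : Bornology.IsBounded Ω
  isConnected : IsConnected Ω
  mem_frontier : A₀ ∈ frontier Ω
  fst_eq : A₀.1 = xMin Ω
  unique : ∀ p ∈ frontier Ω, p.1 = xMin Ω → p = A₀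
  smooth : SmoothBoundaryNear Ω A₀

/-- The unit normal `n(s)` to the right of the tangent `γ'(s)`; with `n = (cos θ, sin θ)` this is
`γ' = (-sin θ, cos θ)`. -/
def normal (γ : ℝ → ℝ × ℝ) (s : ℝ) : ℝ × ℝ := ((deriv γ s).2, -(deriv γ s).1)

/-- `γ`, restricted to `(-r, r)`, is a smooth counterclockwise arc-length parametrization of the
boundary of `Ω` near `A₀ = γ 0`. Counterclockwise means that `normal γ s` points out of `Ω`. -/
structure IsBoundaryParam (Ω : Set (ℝ × ℝ)) (A₀ : ℝ × ℝ) (γ : ℝ → ℝ × ℝ) (r : ℝ) : Prop where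
  pos : 0 < r
  smooth : ContDiffOn ℝ ∞ γ (Ioo (-r) r)
  unit_speed : ∀ s ∈ Ioo (-r) r, (deriv γ s).1 ^ 2 + (deriv γ s).2 ^ 2 = 1
  base : γ 0 = A₀
  mem_frontier : ∀ s ∈ Ioo (-r) r, γ s ∈ frontier Ω
  outward : ∀ s ∈ Ioo (-r) r, ∀ᶠ t in 𝓝[>] (0 : ℝ),
    γ s - t • normal γ s ∈ Ω ∧ γ s + t • normal γ s ∉ closure Ω

/-- The curvature `κ(s)`, given by `γ''(s) = -κ(s) n(s)`, that is `κ = -⟨γ'', n⟩`. -/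
def curvature (γ : ℝ → ℝ × ℝ) (s : ℝ) : ℝ :=
  -((deriv (deriv γ) s).1 * (normal γ s).1 + (deriv (deriv γ) s).2 * (normal γ s).2)

/-- The tubular coordinates `τ(s, t) = γ(s) - t n(s)`. -/
def tubular (γ : ℝ → ℝ × ℝ) (p : ℝ × ℝ) : ℝ × ℝ := γ p.1 - p.2 • normal γ p.1

/-- The Jacobian `m(s, t) = 1 - κ(s) t` of the tubular coordinates. -/
def jac (γ : ℝ → ℝ × ℝ) (p : ℝ × ℝ) : ℝ := 1 - curvature γ p.1 * p.2

/-- The rectangle `W_δ = (-δ, δ) × (0, δ)`. -/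
def rect (δ : ℝ) : Set (ℝ × ℝ) := Ioo (-δ) δ ×ˢ Ioo 0 δ

/-- Elements of `C_c^∞(U; ℂ)`. -/
structure IsTestFunction (U : Set (ℝ × ℝ)) (φ : ℝ × ℝ → ℂ) : Prop where
  smooth : ContDiff ℝ ∞ φ
  compact : HasCompactSupport φ
  support : tsupport φ ⊆ U

/-- `ψ` belongs to `H¹₀(U)` and `(ψs, ψt)` is its (weak) gradient: `(ψ, ψs, ψt)` is a limit in
`L²(U)³` of `(φ, ∂ₛφ, ∂ₜφ)` with `φ ∈ C_c^∞(U)`. -/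
structure HasH10Gradient (U : Set (ℝ × ℝ)) (ψ ψs ψt : ℝ × ℝ → ℂ) : Prop where
  memLp : MemLp ψ 2 (volume.restrict U)
  memLp_s : MemLp ψs 2 (volume.restrict U)
  memLp_t : MemLp ψt 2 (volume.restrict U)
  approx : ∃ φ : ℕ → ℝ × ℝ → ℂ, (∀ n, IsTestFunction U (φ n)) ∧
    Tendsto (fun n => eLpNorm (fun p => φ n p - ψ p) 2 (volume.restrict U)) atTop (𝓝 0) ∧
    Tendsto (fun n => eLpNorm (fun p => fderiv ℝ (φ n) p (1, 0) - ψs p) 2 (volume.restrict U))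
      atTop (𝓝 0) ∧
    Tendsto (fun n => eLpNorm (fun p => fderiv ℝ (φ n) p (0, 1) - ψt p) 2 (volume.restrict U))
      atTop (𝓝 0)

/-- The inner product of `L²(W_δ, m ds dt)` (conjugate-linear in the second variable). -/
def innerM (γ : ℝ → ℝ × ℝ) (δ : ℝ) (f φ : ℝ × ℝ → ℂ) : ℂ :=
  ∫ p in rect δ, f p * conj (φ p) * (jac γ p : ℂ)

/-- The squared norm of `L²(W_δ, m ds dt)`. -/
def normSqM (γ : ℝ → ℝ × ℝ) (δ : ℝ) (ψ : ℝ × ℝ → ℂ) : ℝ :=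
  ∫ p in rect δ, ‖ψ p‖ ^ 2 * jac γ p

/-- The sesquilinear form of `-h² m⁻¹ ∂ₛ m⁻¹ ∂ₛ - h² m⁻¹ ∂ₜ m ∂ₜ + τ₁` in `L²(W_δ, m ds dt)`;
`ψs, ψt` and `φs, φt` are the partial derivatives of `ψ` and `φ`. -/
def formM (γ : ℝ → ℝ × ℝ) (δ h : ℝ) (ψ ψs ψt φ φs φt : ℝ × ℝ → ℂ) : ℂ :=
  ∫ p in rect δ,
    ((h : ℂ) ^ 2 * ((jac γ p : ℂ)⁻¹) ^ 2 * (ψs p * conj (φs p))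
      + (h : ℂ) ^ 2 * (ψt p * conj (φt p))
      + ((tubular γ p).1 : ℂ) * (ψ p * conj (φ p))) * (jac γ p : ℂ)

/-- The graph of the Dirichlet realization `M_h` of
`-h² m⁻¹ ∂ₛ m⁻¹ ∂ₛ - h² m⁻¹ ∂ₜ m ∂ₜ + τ₁` on `L²(W_δ, m ds dt)`, that is, of the self-adjoint
operator associated with the form `formM` on `H¹₀(W_δ)`: `ψ`, with gradient `(ψs, ψt)`, belongs to
the domain of `M_h`, and `M_h ψ = f`. -/
structure IsDirichletRealization (γ : ℝ → ℝ × ℝ) (δ h : ℝ) (ψ ψs ψt f : ℝ × ℝ → ℂ) : Prop where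
  mem_formDomain : HasH10Gradient (rect δ) ψ ψs ψt
  memLp : MemLp f 2 (volume.restrict (rect δ))
  form_eq : ∀ φ φs φt : ℝ × ℝ → ℂ, HasH10Gradient (rect δ) φ φs φt →
    formM γ δ h ψ ψs ψt φ φs φt = innerM γ δ f φ

/-- `ψ`, with gradient `(ψs, ψt)`, is an eigenfunction of `M_h` for the eigenvalue `ev`. -/
structure IsEigenfunction (γ : ℝ → ℝ × ℝ) (δ h ev : ℝ) (ψ ψs ψt : ℝ × ℝ → ℂ) : Prop where
  ne_zero : ¬ ψ =ᵐ[volume.restrict (rect δ)] 0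
  eigen : IsDirichletRealization γ δ h ψ ψs ψt (fun p => (ev : ℂ) * ψ p)

end

end Stark

namespace Stark

/-! This is an Agmon estimate: the eigenvalue equation is tested against `v * ψ` with `v = exp (ε
t^{3/2} / h)`. At the leftmost point the inward normal is the positive first coordinate direction,
so for small `δ` one has `τ₁ ≥ x_min + t/2` on the rectangle (`exists_bounds_rect`). With `ε = 1/3`
the weight satisfies `h² v'² = v² t / 4`, so the cross term `h² v' Re (∂ₜψ ψ̄)` costs half of the
`t`-kinetic energy and only `t/8` of the potential.

What remains, at least `3t/8 - M h^{2/3}`, exceeds `h^{2/3}` once `t > (4M + 4) h^{2/3}`. In the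
layer below, `v` is bounded uniformly in `h`, and the negative part is paid for by `h^{2/3} ‖ψ‖²`.
This is `agmon_pointwise`; integrating it against the identity of `integral_agmonDensity` gives both
bounds at once. -/

theorem xMin_le_fst_of_mem_closure {Ω : Set (ℝ × ℝ)} (hb : Bornology.IsBounded Ω) {p : ℝ × ℝ}
    (hp : p ∈ closure Ω) : xMin Ω ≤ p.1 := by
  have hbd : BddBelow (Prod.fst '' Ω) := hb.image_fst.bddBelow
  have hcl : IsClosed {q : ℝ × ℝ | xMin Ω ≤ q.1} := isClosed_le continuous_const continuous_fst
  exact closure_minimal (fun q hq => csInf_le hbd ⟨q, hq, rfl⟩) hcl hp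

/-! ### Geometry of the boundary near the leftmost point -/

namespace IsBoundaryParam

variable {Ω : Set (ℝ × ℝ)} {A₀ : ℝ × ℝ} {γ : ℝ → ℝ × ℝ} {r : ℝ}

theorem zero_mem (hγ : IsBoundaryParam Ω A₀ γ r) : (0 : ℝ) ∈ Ioo (-r) r :=
  ⟨neg_lt_zero.2 hγ.pos, hγ.pos⟩

theorem contDiffOn_deriv (hγ : IsBoundaryParam Ω A₀ γ r) :
    ContDiffOn ℝ ∞ (deriv γ) (Ioo (-r) r) :=
  ((contDiffOn_infty_iff_deriv_of_isOpen isOpen_Ioo).1 hγ.smooth).2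

theorem continuousOn_deriv_deriv (hγ : IsBoundaryParam Ω A₀ γ r) :
    ContinuousOn (deriv (deriv γ)) (Ioo (-r) r) :=
  ((contDiffOn_infty_iff_deriv_of_isOpen isOpen_Ioo).1 hγ.contDiffOn_deriv).2.continuousOn

theorem continuousOn_curvature (hγ : IsBoundaryParam Ω A₀ γ r) :
    ContinuousOn (curvature γ) (Ioo (-r) r) := by
  have h1 := hγ.contDiffOn_deriv.continuousOn
  have h2 := hγ.continuousOn_deriv_deriv
  unfold curvature normal
  exact ((h2.fst.mul h1.snd).add (h2.snd.mul h1.fst.neg)).neg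

theorem continuousOn_jac (hγ : IsBoundaryParam Ω A₀ γ r) {δ : ℝ} (hδ : δ ≤ r) :
    ContinuousOn (jac γ) (rect δ) := by
  have h1 : ContinuousOn (fun p : ℝ × ℝ => curvature γ p.1) (rect δ) :=
    hγ.continuousOn_curvature.comp continuousOn_fst
      fun p hp => ⟨by linarith [hp.1.1], by linarith [hp.1.2]⟩
  exact continuousOn_const.sub (h1.mul continuousOn_snd)

theorem continuousOn_tubular_fst (hγ : IsBoundaryParam Ω A₀ γ r) {δ : ℝ} (hδ : δ ≤ r) :
    ContinuousOn (fun p => (tubular γ p).1) (rect δ) := by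
  have hm : MapsTo Prod.fst (rect δ) (Ioo (-r) r) :=
    fun p hp => ⟨by linarith [hp.1.1], by linarith [hp.1.2]⟩
  have h0 := hγ.smooth.continuousOn.comp continuousOn_fst hm
  have h1 := hγ.contDiffOn_deriv.continuousOn.comp continuousOn_fst hm
  exact h0.fst.sub (continuousOn_snd.mul h1.snd)

/-- At the leftmost point the tangent of the counterclockwise parametrization points downwards. -/
theorem deriv_snd_zero (hΩ : IsStarkDomain Ω A₀) (hγ : IsBoundaryParam Ω A₀ γ r) :
    (deriv γ 0).2 = -1 := by
  have hI : Ioo (-r) r ∈ 𝓝 (0 : ℝ) := isOpen_Ioo.mem_nhds hγ.zero_mem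
  have hd : HasDerivAt γ (deriv γ 0) 0 :=
    ((hγ.smooth.contDiffAt hI).differentiableAt (by simp)).hasDerivAt
  have hx : (γ 0).1 = xMin Ω := by rw [hγ.base, hΩ.fst_eq]
  have hmin : IsLocalMin (fun s => (γ s).1) 0 := by
    filter_upwards [hI] with s hs
    rw [hx]
    exact xMin_le_fst_of_mem_closure hΩ.isBounded (hγ.mem_frontier s hs).1
  have h1 : (deriv γ 0).1 = 0 := hmin.hasDerivAt_eq_zero hd.fst
  have hu := hγ.unit_speed 0 hγ.zero_mem
  -- A point `γ 0 - t n(0)` lies in `Ω`, hence not to the left of `x_min`; this selects the sign of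
  -- the unit tangent.
  obtain ⟨t, ⟨ht, -⟩, htpos⟩ := ((hγ.outward 0 hγ.zero_mem).and self_mem_nhdsWithin).exists
  have hle := xMin_le_fst_of_mem_closure hΩ.isBounded (subset_closure ht)
  have hneg : (deriv γ 0).2 ≤ 0 := by
    simp only [normal, Prod.fst_sub, Prod.smul_fst, smul_eq_mul, hx] at hle
    have : 0 < t := htpos
    nlinarith
  rw [h1] at hu
  nlinarith

theorem exists_bounds_rect (hΩ : IsStarkDomain Ω A₀) (hγ : IsBoundaryParam Ω A₀ γ r) :
    ∃ δ₀ > 0, δ₀ ≤ r ∧ ∃ B, ∀ δ < δ₀, ∀ p ∈ rect δ,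
      1 / 2 ≤ jac γ p ∧ jac γ p ≤ 3 / 2 ∧ xMin Ω + p.2 / 2 ≤ (tubular γ p).1 ∧
        |(tubular γ p).1| ≤ B := by
  have hI : Ioo (-r) r ∈ 𝓝 (0 : ℝ) := isOpen_Ioo.mem_nhds hγ.zero_mem
  have c0 := (hγ.smooth.continuousOn.continuousAt hI).fst
  have c1 := (hγ.contDiffOn_deriv.continuousOn.continuousAt hI).snd
  have c2 := (hγ.continuousOn_curvature.continuousAt hI).abs
  have e0 : ∀ᶠ s in 𝓝 (0 : ℝ), |(γ s).1| < |(γ 0).1| + 1 :=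
    c0.abs.eventually_lt continuousAt_const (lt_add_one _)
  have e1 : ∀ᶠ s in 𝓝 (0 : ℝ), (deriv γ s).2 < -(1 / 2) :=
    c1.eventually_lt continuousAt_const (by rw [deriv_snd_zero hΩ hγ]; norm_num)
  have e2 : ∀ᶠ s in 𝓝 (0 : ℝ), |curvature γ s| < |curvature γ 0| + 1 :=
    c2.eventually_lt continuousAt_const (lt_add_one _)
  obtain ⟨d, hd, H⟩ := Metric.eventually_nhds_iff.1 (e0.and (e1.and e2))
  set K := |curvature γ 0| + 1 with hK
  have hKpos : 0 < K := by positivity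
  -- The bound `1 / (2K)` gives `|κ t| ≤ 1/2`; the bound `1` gives `t |γ₂'| ≤ 1`, which accounts for
  -- one unit of the `2` in `B`.
  refine ⟨min (min d r) (min 1 (1 / (2 * K))), by have := hγ.pos; positivity,
    (min_le_left _ _).trans (min_le_right _ _), |(γ 0).1| + 2, fun δ hδ p hp => ?_⟩
  obtain ⟨⟨hp1, hp2⟩, hp3, hp4⟩ := hp
  simp only [lt_min_iff] at hδ
  obtain ⟨⟨hδd, hδr⟩, hδ1, hδK⟩ := hδ
  have habs : |p.1| < δ := abs_lt.2 ⟨hp1, hp2⟩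
  obtain ⟨b0, b1, b2⟩ := H (y := p.1) (by rw [Real.dist_eq, sub_zero]; linarith)
  have hs : p.1 ∈ Ioo (-r) r := ⟨by linarith, by linarith⟩
  have hx := xMin_le_fst_of_mem_closure hΩ.isBounded (hγ.mem_frontier _ hs).1
  have hu := hγ.unit_speed _ hs
  have hdm : -1 ≤ (deriv γ p.1).2 := by nlinarith [sq_nonneg (deriv γ p.1).1]
  have hKt : K * p.2 ≤ 1 / 2 := by
    have h1 : p.2 ≤ 1 / (2 * K) := by linarith
    calc K * p.2 ≤ K * (1 / (2 * K)) := by gcongr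
      _ = 1 / 2 := by field_simp
  have hkt : |curvature γ p.1 * p.2| ≤ 1 / 2 := by
    rw [abs_mul, abs_of_pos hp3]
    nlinarith
  have ht : (tubular γ p).1 = (γ p.1).1 - p.2 * (deriv γ p.1).2 := rfl
  rw [abs_le] at hkt
  rw [abs_lt] at b0
  refine ⟨by unfold jac; linarith, by unfold jac; linarith, ?_, ?_⟩
  · rw [ht]; nlinarith
  · rw [ht, abs_le]; constructor <;> nlinarith

end IsBoundaryParam

/-! ### The Agmon weight as a multiplier on `H¹₀` -/

theorem measurableSet_rect (δ : ℝ) : MeasurableSet (rect δ) :=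
  measurableSet_Ioo.prod measurableSet_Ioo

/-- The Agmon weight `exp (ε t^{3/2} / h)`. -/
noncomputable def weight (ε h t : ℝ) : ℝ := Real.exp (ε * t ^ (3 / 2 : ℝ) / h)

/-- The derivative of the Agmon weight. -/
noncomputable def weightDeriv (ε h t : ℝ) : ℝ := weight ε h t * (ε * (3 / 2 * t ^ (1 / 2 : ℝ)) / h)

theorem continuous_weight (ε h : ℝ) : Continuous (weight ε h) := by
  unfold weight
  exact Real.continuous_exp.comp
    ((continuous_const.mul (Real.continuous_rpow_const (by norm_num))).div_const _)

theorem continuous_weightDeriv (ε h : ℝ) : Continuous (weightDeriv ε h) := by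
  unfold weightDeriv
  exact (continuous_weight ε h).mul ((continuous_const.mul (continuous_const.mul
    (Real.continuous_rpow_const (by norm_num)))).div_const _)

/-- Valid at `t = 0` too, because the exponent `3/2` is at least `1`. -/
theorem hasDerivAt_weight (ε h : ℝ) (t : ℝ) : HasDerivAt (weight ε h) (weightDeriv ε h t) t := by
  have h1 := (Real.hasDerivAt_rpow_const (x := t) (p := 3 / 2) (Or.inr (by norm_num)))
  have h2 := ((h1.const_mul ε).div_const h).exp
  norm_num at h2
  exact h2

theorem contDiffAt_weight (ε h : ℝ) {t : ℝ} (ht : 0 < t) : ContDiffAt ℝ ∞ (weight ε h) t :=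
  ((contDiffAt_const.mul (Real.contDiffAt_rpow_const_of_ne ht.ne')).div_const h).exp

/-- Since `t` stays in a bounded interval, the weight and its derivative are bounded for fixed `h`,
so the Agmon argument needs no truncation of the weight. -/
theorem exists_bound_rect {f : ℝ → ℝ} (hf : Continuous f) (δ : ℝ) :
    ∃ B, ∀ p ∈ rect δ, ‖f p.2‖ ≤ B := by
  obtain ⟨B, hB⟩ := isCompact_Icc.exists_bound_of_continuousOn (s := Icc 0 δ) hf.continuousOn
  exact ⟨B, fun p hp => hB _ ⟨hp.2.1.le, hp.2.2.le⟩⟩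

theorem memLp_mul_snd {f : ℝ → ℝ} (hf : Continuous f) {δ : ℝ} {ψ : ℝ × ℝ → ℂ}
    (hψ : MemLp ψ 2 (volume.restrict (rect δ))) :
    MemLp (fun p => (f p.2 : ℂ) * ψ p) 2 (volume.restrict (rect δ)) := by
  obtain ⟨B, hB⟩ := exists_bound_rect hf δ
  refine hψ.of_le_mul (c := B)
    ((by fun_prop : Continuous fun p : ℝ × ℝ => (f p.2 : ℂ)).aestronglyMeasurable.mul hψ.1) ?_
  filter_upwards [ae_restrict_mem (measurableSet_rect δ)] with p hp
  rw [norm_mul, Complex.norm_real]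
  exact mul_le_mul_of_nonneg_right (hB p hp) (norm_nonneg _)

theorem tendsto_eLpNorm_mul_snd {f : ℝ → ℝ} (hf : Continuous f) {δ : ℝ} {u : ℕ → ℝ × ℝ → ℂ}
    (hu : Tendsto (fun n => eLpNorm (u n) 2 (volume.restrict (rect δ))) atTop (𝓝 0)) :
    Tendsto (fun n => eLpNorm (fun p => (f p.2 : ℂ) * u n p) 2 (volume.restrict (rect δ)))
      atTop (𝓝 0) := by
  obtain ⟨B, hB⟩ := exists_bound_rect hf δ
  have h0 := ENNReal.Tendsto.const_mul hu (Or.inr (ENNReal.ofReal_ne_top (r := B)))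
  rw [mul_zero] at h0
  refine tendsto_of_tendsto_of_tendsto_of_le_of_le tendsto_const_nhds h0 (fun _ => zero_le)
    fun n => eLpNorm_le_mul_eLpNorm_of_ae_le_mul ?_ 2
  filter_upwards [ae_restrict_mem (measurableSet_rect δ)] with p hp
  rw [norm_mul, Complex.norm_real]
  exact mul_le_mul_of_nonneg_right (hB p hp) (norm_nonneg _)

theorem IsTestFunction.weight_mul {δ : ℝ} {φ : ℝ × ℝ → ℂ} (hφ : IsTestFunction (rect δ) φ)
    (ε h : ℝ) : IsTestFunction (rect δ) (fun p => (weight ε h p.2 : ℂ) * φ p) where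
  smooth := by
    refine contDiff_iff_contDiffAt.2 fun p => ?_
    -- The weight need not be smooth at `t = 0`, but the support of `φ` lies in `t > 0`.
    by_cases hp : p ∈ tsupport φ
    · have h1 : ContDiffAt ℝ ∞ (fun q : ℝ × ℝ => weight ε h q.2) p :=
        (contDiffAt_weight ε h (hφ.support hp).2.1).comp p contDiffAt_snd
      exact (Complex.ofRealCLM.contDiff.contDiffAt.comp p h1).mul hφ.smooth.contDiffAt
    · have : (fun p => (weight ε h p.2 : ℂ) * φ p) =ᶠ[𝓝 p] fun _ => 0 := by
        filter_upwards [notMem_tsupport_iff_eventuallyEq.1 hp] with q hq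
        simp [hq]
      exact contDiffAt_const.congr_of_eventuallyEq this
  compact := hφ.compact.mul_left
  support := (tsupport_mul_subset_right).trans hφ.support

theorem fderiv_weight_mul {φ : ℝ × ℝ → ℂ} (hφ : ContDiff ℝ ∞ φ) (ε h : ℝ) (p v : ℝ × ℝ) :
    fderiv ℝ (fun p => (weight ε h p.2 : ℂ) * φ p) p v =
      (weight ε h p.2 : ℂ) * fderiv ℝ φ p v + (v.2 * weightDeriv ε h p.2 : ℝ) * φ p := by
  have h1 : HasFDerivAt (fun q : ℝ × ℝ => weight ε h q.2)
      (weightDeriv ε h p.2 • ContinuousLinearMap.snd ℝ ℝ ℝ) p :=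
    (hasDerivAt_weight ε h p.2).comp_hasFDerivAt p hasFDerivAt_snd
  have h2 := Complex.ofRealCLM.hasFDerivAt.comp p h1
  have h3 := h2.mul ((hφ.differentiable (by simp)) p).hasFDerivAt
  have h4 : HasFDerivAt (fun p => (weight ε h p.2 : ℂ) * φ p) _ p := h3
  rw [h4.fderiv]
  simp
  ring

/-- Multiplication by the Agmon weight preserves `H¹₀` of the rectangle. -/
theorem HasH10Gradient.weight_mul {δ : ℝ} {ψ ψs ψt : ℝ × ℝ → ℂ}
    (H : HasH10Gradient (rect δ) ψ ψs ψt) (ε h : ℝ) :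
    HasH10Gradient (rect δ) (fun p => (weight ε h p.2 : ℂ) * ψ p)
      (fun p => (weight ε h p.2 : ℂ) * ψs p)
      (fun p => (weight ε h p.2 : ℂ) * ψt p + (weightDeriv ε h p.2 : ℂ) * ψ p) := by
  have cw := continuous_weight ε h
  have cd := continuous_weightDeriv ε h
  refine ⟨memLp_mul_snd cw H.memLp, memLp_mul_snd cw H.memLp_s,
    (memLp_mul_snd cw H.memLp_t).add (memLp_mul_snd cd H.memLp), ?_⟩
  obtain ⟨φ, hφ, h0, hs, ht⟩ := H.approx
  refine ⟨fun n p => (weight ε h p.2 : ℂ) * φ n p, fun n => (hφ n).weight_mul ε h, ?_, ?_, ?_⟩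
  · simpa only [mul_sub] using tendsto_eLpNorm_mul_snd cw h0
  · have := tendsto_eLpNorm_mul_snd cw hs
    simpa only [fderiv_weight_mul (hφ _).smooth, mul_sub, zero_mul, Complex.ofReal_zero, add_zero]
      using this
  · have h1 := tendsto_eLpNorm_mul_snd cw ht
    have h2 := tendsto_eLpNorm_mul_snd cd h0
    have h12 := h1.add h2
    rw [add_zero] at h12
    refine tendsto_of_tendsto_of_tendsto_of_le_of_le tendsto_const_nhds h12 (fun _ => zero_le)
      fun n => ?_
    have m1 : AEStronglyMeasurable (fun p => (weight ε h p.2 : ℂ) *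
        (fderiv ℝ (φ n) p (0, 1) - ψt p)) (volume.restrict (rect δ)) :=
      (by fun_prop : Continuous fun p : ℝ × ℝ => (weight ε h p.2 : ℂ)).aestronglyMeasurable.mul
        ((((hφ n).smooth.continuous_fderiv (by simp)).clm_apply
          continuous_const).aestronglyMeasurable.sub H.memLp_t.1)
    have m2 : AEStronglyMeasurable (fun p => (weightDeriv ε h p.2 : ℂ) * (φ n p - ψ p))
        (volume.restrict (rect δ)) :=
      (by fun_prop : Continuous fun p : ℝ × ℝ =>
        (weightDeriv ε h p.2 : ℂ)).aestronglyMeasurable.mul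
        ((hφ n).smooth.continuous.aestronglyMeasurable.sub H.memLp.1)
    refine le_of_eq_of_le (congrArg (fun g => eLpNorm g 2 _) ?_) (eLpNorm_add_le m1 m2 (by norm_num))
    funext p
    simp only [fderiv_weight_mul (hφ n).smooth, Pi.add_apply, one_mul]
    ring

/-! ### Integrability and pointwise estimates -/

/-- A bounded measurable multiple of `f * conj g` is integrable for square integrable `f, g`. -/
theorem integrable_bdd_mul_conj {μ : Measure (ℝ × ℝ)} {b : ℝ × ℝ → ℝ} {f g : ℝ × ℝ → ℂ} {B : ℝ}
    (hf : MemLp f 2 μ) (hg : MemLp g 2 μ) (hb : AEStronglyMeasurable b μ)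
    (hB : ∀ᵐ p ∂μ, ‖b p‖ ≤ B) : Integrable (fun p => (b p : ℂ) * (f p * conj (g p))) μ := by
  have hg' : MemLp (fun p => conj (g p)) 2 μ := hg.star
  refine (hf.integrable_mul hg').bdd_mul (c := B)
    (Complex.continuous_ofReal.comp_aestronglyMeasurable hb) ?_
  filter_upwards [hB] with p hp
  rwa [Complex.norm_real]

/-- The pointwise inequality behind the Agmon estimate, with `v'` the derivative of the weight
`v`, `a = |ψ|`, `b = |∂ₛψ|`, `c = |∂ₜψ|`, `x = Re (∂ₜψ ψ̄)` and `H = h^{2/3}`. -/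
theorem agmon_pointwise {h H M W t m τ v v' a b c x : ℝ} (hM : 0 < M)
    (hH : 0 < H) (ht : 0 < t) (hm : 1 / 2 ≤ m) (hm' : m ≤ 3 / 2) (hτ : t / 2 - M * H ≤ τ)
    (hv : 0 < v) (hW : 1 ≤ W) (hvW : t ≤ (4 * M + 4) * H → v ≤ W)
    (hx : |x| ≤ c * a) (hv' : h ^ 2 * v' ^ 2 ≤ v ^ 2 * t / 4) :
    1 / 4 * (v * (h ^ 2 * (b ^ 2 + c ^ 2))) + H / 2 * (v * a ^ 2)
        - (M + 1) * W * H * (a ^ 2 * m) ≤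
      h ^ 2 * m⁻¹ * v * b ^ 2 + h ^ 2 * m * (v * c ^ 2 + v' * x) + τ * m * v * a ^ 2 := by
  have hm0 : 0 < m := by linarith
  have h1 : 1 / 4 * (v * (h ^ 2 * b ^ 2)) ≤ h ^ 2 * m⁻¹ * v * b ^ 2 := by
    have : 1 / 4 ≤ m⁻¹ := by rw [le_inv_comm₀ (by norm_num) hm0]; linarith
    nlinarith [mul_le_mul_of_nonneg_right this (by positivity : 0 ≤ v * (h ^ 2 * b ^ 2))]
  -- Young's inequality for the cross term, proved after multiplication by `v` so that `v'² / v`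
  -- never appears.
  have h2 : h ^ 2 * (v * c ^ 2) / 2 - v * t / 8 * a ^ 2 ≤ h ^ 2 * (v * c ^ 2 + v' * x) := by
    have hx2 : -(|v'| * (c * a)) ≤ v' * x := by
      have : |v' * x| ≤ |v'| * (c * a) := by rw [abs_mul]; gcongr
      linarith [neg_abs_le (v' * x)]
    have h3 : v * (|v'| * (c * a)) ≤ v * (v * c ^ 2 / 2) + v' ^ 2 / 2 * a ^ 2 := by
      rw [← sq_abs v']
      nlinarith [sq_nonneg (v * c - |v'| * a)]
    have h4 : h ^ 2 * v' ^ 2 * a ^ 2 ≤ v ^ 2 * t / 4 * a ^ 2 := by gcongr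
    have h5 : v * (h ^ 2 * (v * c ^ 2) / 2 - v * t / 8 * a ^ 2)
        ≤ v * (h ^ 2 * (v * c ^ 2 + v' * x)) := by
      have := mul_le_mul_of_nonneg_left h3 (sq_nonneg h)
      have := mul_le_mul_of_nonneg_left hx2 (by positivity : 0 ≤ h ^ 2 * v)
      linarith
    exact le_of_mul_le_mul_left h5 hv
  have h6 : m * (h ^ 2 * (v * c ^ 2) / 2 - v * t / 8 * a ^ 2)
      ≤ m * (h ^ 2 * (v * c ^ 2 + v' * x)) := by gcongr
  have h7 : 1 / 4 * (v * (h ^ 2 * c ^ 2)) ≤ m * (h ^ 2 * (v * c ^ 2) / 2) := by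
    nlinarith [mul_le_mul_of_nonneg_right hm (by positivity : 0 ≤ v * (h ^ 2 * c ^ 2))]
  -- Inside the layer `v ≤ W`; outside it, `3t/8 - M H ≥ H`, which is what the threshold `4M + 4`
  -- ensures.
  have h8 : H * v - (M + 1) * W * H ≤ (τ - t / 8) * v := by
    rcases le_or_gt t ((4 * M + 4) * H) with hc | hc
    · have hvw := hvW hc
      have : (M + 1) * H * v ≤ (M + 1) * H * W := by gcongr
      have : (-(M * H)) * v ≤ (τ - t / 8) * v := by gcongr; linarith
      linarith
    · have : H * v ≤ (τ - t / 8) * v := by gcongr; nlinarith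
      have : 0 < (M + 1) * W * H := by positivity
      linarith
  have h9 := mul_le_mul_of_nonneg_right h8 (by positivity : 0 ≤ m * a ^ 2)
  have h10 : H / 2 * (v * a ^ 2) ≤ H * v * (m * a ^ 2) := by
    nlinarith [mul_le_mul_of_nonneg_right hm (by positivity : 0 ≤ H * v * a ^ 2)]
  linarith

/-- The value `ε = 1/3` makes `h v' = v √t / 2`. -/
theorem sq_mul_weightDeriv_sq {h t : ℝ} (hh : 0 < h) (ht : 0 < t) :
    h ^ 2 * weightDeriv (1 / 3) h t ^ 2 = weight (1 / 3) h t ^ 2 * t / 4 := by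
  have : (t ^ (1 / 2 : ℝ)) ^ 2 = t := by
    rw [← Real.sqrt_eq_rpow, Real.sq_sqrt ht.le]
  unfold weightDeriv
  rw [mul_pow, div_pow, mul_pow, mul_pow, this]
  field_simp
  ring

/-- By scaling, `t ≤ K h^{2/3}` means `t^{3/2} / h ≤ K^{3/2}`, a bound independent of `h`. -/
theorem weight_le_exp {h t K : ℝ} (hh : 0 < h) (ht : 0 < t) (hK : 0 ≤ K)
    (h1 : t ≤ K * h ^ (2 / 3 : ℝ)) : weight (1 / 3) h t ≤ Real.exp (K ^ (3 / 2 : ℝ)) := by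
  refine Real.exp_le_exp.2 ?_
  have h2 : t ^ (3 / 2 : ℝ) ≤ K ^ (3 / 2 : ℝ) * h := by
    calc t ^ (3 / 2 : ℝ) ≤ (K * h ^ (2 / 3 : ℝ)) ^ (3 / 2 : ℝ) :=
          Real.rpow_le_rpow ht.le h1 (by norm_num)
      _ = K ^ (3 / 2 : ℝ) * h := by
          rw [Real.mul_rpow hK (by positivity), ← Real.rpow_mul hh.le]
          norm_num
  rw [div_le_iff₀ hh]
  have : 0 ≤ t ^ (3 / 2 : ℝ) := by positivity
  linarith

end Stark

/-! ### The weighted energy identity -/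

namespace Stark

section Agmon

variable {γ : ℝ → ℝ × ℝ} {δ h ev B : ℝ} {ψ ψs ψt : ℝ × ℝ → ℂ}

/-- The energy density of the Agmon estimate: the real part of the form evaluated at
`(ψ, weight * ψ)`, minus the eigenvalue term. -/
noncomputable def agmonDensity (γ : ℝ → ℝ × ℝ) (h ev : ℝ) (ψ ψs ψt : ℝ × ℝ → ℂ) (p : ℝ × ℝ) : ℝ :=
  h ^ 2 * (jac γ p)⁻¹ * weight (1 / 3) h p.2 * ‖ψs p‖ ^ 2 +
    h ^ 2 * jac γ p * (weight (1 / 3) h p.2 * ‖ψt p‖ ^ 2 +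
      weightDeriv (1 / 3) h p.2 * (ψt p * conj (ψ p)).re) +
    ((tubular γ p).1 - ev) * jac γ p * weight (1 / 3) h p.2 * ‖ψ p‖ ^ 2

/-- Testing the eigenvalue equation against `weight * ψ`. -/
theorem IsEigenfunction.integral_agmonDensity (hE : IsEigenfunction γ δ h ev ψ ψs ψt)
    (cj : ContinuousOn (jac γ) (rect δ)) (ct : ContinuousOn (fun p => (tubular γ p).1) (rect δ))
    (hj : ∀ p ∈ rect δ, 1 / 2 ≤ jac γ p) (hj' : ∀ p ∈ rect δ, jac γ p ≤ 3 / 2)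
    (hB : ∀ p ∈ rect δ, |(tubular γ p).1| ≤ B) :
    IntegrableOn (agmonDensity γ h ev ψ ψs ψt) (rect δ) ∧
      ∫ p in rect δ, agmonDensity γ h ev ψ ψs ψt p = 0 := by
  have hR := measurableSet_rect δ
  obtain ⟨L, Ls, Lt, -⟩ := hE.eigen.mem_formDomain
  have mj : AEStronglyMeasurable (jac γ) (volume.restrict (rect δ)) := cj.aestronglyMeasurable hR
  have mji : AEStronglyMeasurable (fun p => (jac γ p)⁻¹) (volume.restrict (rect δ)) :=
    (cj.inv₀ fun p hp => by linarith [hj p hp]).aestronglyMeasurable hR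
  have mt : AEStronglyMeasurable (fun p => (tubular γ p).1) (volume.restrict (rect δ)) :=
    ct.aestronglyMeasurable hR
  have cw := continuous_weight (1 / 3) h
  have cd := continuous_weightDeriv (1 / 3) h
  have mw : AEStronglyMeasurable (fun p : ℝ × ℝ => weight (1 / 3) h p.2)
      (volume.restrict (rect δ)) := (cw.comp continuous_snd).aestronglyMeasurable
  have md : AEStronglyMeasurable (fun p : ℝ × ℝ => weightDeriv (1 / 3) h p.2)
      (volume.restrict (rect δ)) := (cd.comp continuous_snd).aestronglyMeasurable
  obtain ⟨V, hV⟩ := exists_bound_rect cw δ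
  obtain ⟨D, hD⟩ := exists_bound_rect cd δ
  have hjn : ∀ p ∈ rect δ, ‖jac γ p‖ ≤ 3 / 2 := fun p hp => by
    rw [Real.norm_eq_abs, abs_of_pos (by linarith [hj p hp])]; exact hj' p hp
  have hjin : ∀ p ∈ rect δ, ‖(jac γ p)⁻¹‖ ≤ 2 := fun p hp => by
    have := hj p hp
    rw [Real.norm_eq_abs, abs_of_pos (by positivity), inv_le_comm₀ (by linarith) two_pos]
    linarith
  have Is : IntegrableOn (fun p => ((h ^ 2 * (jac γ p)⁻¹ * weight (1 / 3) h p.2 : ℝ) : ℂ) *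
      (ψs p * conj (ψs p))) (rect δ) := by
    refine integrable_bdd_mul_conj (B := ‖h ^ 2‖ * 2 * V) Ls Ls ((mji.const_mul _).mul mw) ?_
    filter_upwards [ae_restrict_mem hR] with p hp
    rw [norm_mul, norm_mul]
    gcongr
    exacts [hjin p hp, hV p hp]
  have It : IntegrableOn (fun p => ((h ^ 2 * jac γ p * weight (1 / 3) h p.2 : ℝ) : ℂ) *
      (ψt p * conj (ψt p))) (rect δ) := by
    refine integrable_bdd_mul_conj (B := ‖h ^ 2‖ * (3 / 2) * V) Lt Lt
      ((mj.const_mul _).mul mw) ?_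
    filter_upwards [ae_restrict_mem hR] with p hp
    rw [norm_mul, norm_mul]
    gcongr
    exacts [hjn p hp, hV p hp]
  have Ix : IntegrableOn (fun p => ((h ^ 2 * jac γ p * weightDeriv (1 / 3) h p.2 : ℝ) : ℂ) *
      (ψt p * conj (ψ p))) (rect δ) := by
    refine integrable_bdd_mul_conj (B := ‖h ^ 2‖ * (3 / 2) * D) Lt L
      ((mj.const_mul _).mul md) ?_
    filter_upwards [ae_restrict_mem hR] with p hp
    rw [norm_mul, norm_mul]
    gcongr
    exacts [hjn p hp, hD p hp]
  have I0 : IntegrableOn (fun p => (((tubular γ p).1 * jac γ p * weight (1 / 3) h p.2 : ℝ) : ℂ) *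
      (ψ p * conj (ψ p))) (rect δ) := by
    refine integrable_bdd_mul_conj (B := B * (3 / 2) * V) L L ((mt.mul mj).mul mw) ?_
    filter_upwards [ae_restrict_mem hR] with p hp
    have hB0 : 0 ≤ B := (abs_nonneg _).trans (hB p hp)
    rw [norm_mul, norm_mul]
    gcongr
    exacts [hB p hp, hjn p hp, hV p hp]
  have Ie : IntegrableOn (fun p => ((ev * jac γ p * weight (1 / 3) h p.2 : ℝ) : ℂ) *
      (ψ p * conj (ψ p))) (rect δ) := by
    refine integrable_bdd_mul_conj (B := ‖ev‖ * (3 / 2) * V) L L ((mj.const_mul _).mul mw) ?_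
    filter_upwards [ae_restrict_mem hR] with p hp
    rw [norm_mul, norm_mul]
    gcongr
    exacts [hjn p hp, hV p hp]
  have If := ((Is.add It).add Ix).add I0
  have key := hE.eigen.form_eq _ _ _ (hE.eigen.mem_formDomain.weight_mul (1 / 3) h)
  have hform : formM γ δ h ψ ψs ψt (fun p => (weight (1 / 3) h p.2 : ℂ) * ψ p)
      (fun p => (weight (1 / 3) h p.2 : ℂ) * ψs p)
      (fun p => (weight (1 / 3) h p.2 : ℂ) * ψt p + (weightDeriv (1 / 3) h p.2 : ℂ) * ψ p) = _ :=
    setIntegral_congr_fun (g := fun p =>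
      ((h ^ 2 * (jac γ p)⁻¹ * weight (1 / 3) h p.2 : ℝ) : ℂ) * (ψs p * conj (ψs p)) +
      ((h ^ 2 * jac γ p * weight (1 / 3) h p.2 : ℝ) : ℂ) * (ψt p * conj (ψt p)) +
      ((h ^ 2 * jac γ p * weightDeriv (1 / 3) h p.2 : ℝ) : ℂ) * (ψt p * conj (ψ p)) +
      (((tubular γ p).1 * jac γ p * weight (1 / 3) h p.2 : ℝ) : ℂ) * (ψ p * conj (ψ p))) hR
      fun p hp => by
        have hj0 : (jac γ p : ℂ) ≠ 0 := Complex.ofReal_ne_zero.2 (by linarith [hj p hp])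
        simp only [map_mul, map_add, Complex.conj_ofReal]
        push_cast
        field_simp
        ring
  have hinner : innerM γ δ (fun p => (ev : ℂ) * ψ p)
      (fun p => (weight (1 / 3) h p.2 : ℂ) * ψ p) = _ :=
    setIntegral_congr_fun (g := fun p =>
      ((ev * jac γ p * weight (1 / 3) h p.2 : ℝ) : ℂ) * (ψ p * conj (ψ p))) hR
      fun p hp => by
        simp only [map_mul, Complex.conj_ofReal]
        push_cast
        ring
  have hre : ∀ p, agmonDensity γ h ev ψ ψs ψt p = RCLike.re
      (((h ^ 2 * (jac γ p)⁻¹ * weight (1 / 3) h p.2 : ℝ) : ℂ) * (ψs p * conj (ψs p)) +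
      ((h ^ 2 * jac γ p * weight (1 / 3) h p.2 : ℝ) : ℂ) * (ψt p * conj (ψt p)) +
      ((h ^ 2 * jac γ p * weightDeriv (1 / 3) h p.2 : ℝ) : ℂ) * (ψt p * conj (ψ p)) +
      (((tubular γ p).1 * jac γ p * weight (1 / 3) h p.2 : ℝ) : ℂ) * (ψ p * conj (ψ p)) -
      ((ev * jac γ p * weight (1 / 3) h p.2 : ℝ) : ℂ) * (ψ p * conj (ψ p))) := fun p => by
    have hn : ∀ z : ℂ, (z * conj z).re = ‖z‖ ^ 2 := fun z => by
      rw [Complex.mul_conj, Complex.ofReal_re, Complex.normSq_eq_norm_sq]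
    simp only [RCLike.re_to_complex, Complex.add_re, Complex.sub_re, Complex.re_ofReal_mul, hn,
      agmonDensity]
    ring
  have Id := Integrable.sub If Ie
  rw [hform, hinner] at key
  refine ⟨Id.re.congr (ae_of_all _ fun p => (hre p).symm), ?_⟩
  rw [integral_congr_ae (ae_of_all _ hre)]
  exact (integral_re Id).trans
    ((congrArg _ ((integral_sub If Ie).trans (sub_eq_zero.2 key))).trans (map_zero _))

theorem integrableOn_continuous_mul_sq {f : ℝ → ℝ} (hf : Continuous f)
    (hψ : MemLp ψ 2 (volume.restrict (rect δ))) :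
    IntegrableOn (fun p => f p.2 * ‖ψ p‖ ^ 2) (rect δ) := by
  obtain ⟨D, hD⟩ := exists_bound_rect hf δ
  refine Integrable.bdd_mul (c := D) (hψ.integrable_norm_pow two_ne_zero)
    (hf.comp continuous_snd).aestronglyMeasurable ?_
  filter_upwards [ae_restrict_mem (measurableSet_rect δ)] with p hp using hD p hp

end Agmon

end Stark

/-! ### Integration of the pointwise inequality -/

open Stark in
theorem mainTheorem7 (Ω : Set (ℝ × ℝ)) (A₀ : ℝ × ℝ) (hΩ : Stark.IsStarkDomain Ω A₀)
    (γ : ℝ → ℝ × ℝ) (r : ℝ) (hγ : Stark.IsBoundaryParam Ω A₀ γ r)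
    (hκ : 0 < Stark.curvature γ 0) :
    ∃ δ₀ > 0, ∀ δ : ℝ, 0 < δ → δ < δ₀ →
      ∀ M > 0, ∃ ε > 0, ∃ C > 0, ∃ h₀ > 0, ∀ h : ℝ, 0 < h → h < h₀ →
        ∀ (ev : ℝ) (ψ ψs ψt : ℝ × ℝ → ℂ), Stark.IsEigenfunction γ δ h ev ψ ψs ψt →
          ev ≤ Stark.xMin Ω + M * h ^ (2 / 3 : ℝ) →
          (IntegrableOn (fun p => Real.exp (ε * p.2 ^ (3 / 2 : ℝ) / h) * ‖ψ p‖ ^ 2)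
              (Stark.rect δ) ∧
            ∫ p in Stark.rect δ, Real.exp (ε * p.2 ^ (3 / 2 : ℝ) / h) * ‖ψ p‖ ^ 2
              ≤ C * Stark.normSqM γ δ ψ) ∧
          (IntegrableOn (fun p => Real.exp (ε * p.2 ^ (3 / 2 : ℝ) / h)
              * (h ^ 2 * (‖ψs p‖ ^ 2 + ‖ψt p‖ ^ 2))) (Stark.rect δ) ∧
            ∫ p in Stark.rect δ, Real.exp (ε * p.2 ^ (3 / 2 : ℝ) / h)
                * (h ^ 2 * (‖ψs p‖ ^ 2 + ‖ψt p‖ ^ 2))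
              ≤ C * h ^ (2 / 3 : ℝ) * Stark.normSqM γ δ ψ) := by
  obtain ⟨δ₀, hδ₀, hδr, B, hbd⟩ := Stark.IsBoundaryParam.exists_bounds_rect hΩ hγ
  refine ⟨δ₀, hδ₀, fun δ _ hδ M hM => ?_⟩
  have hbd := hbd δ hδ
  set W : ℝ := Real.exp ((4 * M + 4) ^ (3 / 2 : ℝ)) with hWdef
  have hW : 1 ≤ W := Real.one_le_exp (by positivity)
  -- The factor `4` cancels the `1/4` before the gradient term; the bound on `ψ` would need only
  -- `2`. No smallness of `h` is required, so `h₀ = 1` is arbitrary.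
  refine ⟨1 / 3, by norm_num, 4 * ((M + 1) * W), by positivity, 1, one_pos,
    fun h hh _ ev ψ ψs ψt hE hev => ?_⟩
  set H : ℝ := h ^ (2 / 3 : ℝ) with hHdef
  have hH : 0 < H := by positivity
  have hR := measurableSet_rect δ
  have cj := hγ.continuousOn_jac (hδ.le.trans hδr)
  obtain ⟨L, Ls, Lt, -⟩ := hE.eigen.mem_formDomain
  obtain ⟨ID, hD⟩ := hE.integral_agmonDensity cj
    (hγ.continuousOn_tubular_fst (hδ.le.trans hδr)) (fun p hp => (hbd p hp).1)
    (fun p hp => (hbd p hp).2.1) (fun p hp => (hbd p hp).2.2.2)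
  have cw := continuous_weight (1 / 3) h
  have IV : IntegrableOn (fun p : ℝ × ℝ => weight (1 / 3) h p.2 * ‖ψ p‖ ^ 2) (rect δ) :=
    integrableOn_continuous_mul_sq cw L
  have IG : IntegrableOn (fun p : ℝ × ℝ => weight (1 / 3) h p.2 *
      (h ^ 2 * (‖ψs p‖ ^ 2 + ‖ψt p‖ ^ 2))) (rect δ) := by
    refine (((integrableOn_continuous_mul_sq cw Ls).add
      (integrableOn_continuous_mul_sq cw Lt)).const_mul (h ^ 2)).congr (ae_of_all _ fun p => ?_)
    simp only [Pi.add_apply]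
    ring
  have IN : IntegrableOn (fun p => ‖ψ p‖ ^ 2 * jac γ p) (rect δ) := by
    refine Integrable.mul_bdd (c := 3 / 2) (L.integrable_norm_pow two_ne_zero)
      (cj.aestronglyMeasurable hR) ?_
    filter_upwards [ae_restrict_mem hR] with p hp
    rw [Real.norm_eq_abs, abs_of_pos (by linarith [(hbd p hp).1])]
    exact (hbd p hp).2.1
  have hle : ∀ p ∈ rect δ, 1 / 4 * (weight (1 / 3) h p.2 * (h ^ 2 * (‖ψs p‖ ^ 2 + ‖ψt p‖ ^ 2))) +
      H / 2 * (weight (1 / 3) h p.2 * ‖ψ p‖ ^ 2) - (M + 1) * W * H * (‖ψ p‖ ^ 2 * jac γ p) ≤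
        agmonDensity γ h ev ψ ψs ψt p := fun p hp => by
    obtain ⟨hj, hj', hx, -⟩ := hbd p hp
    have ht : 0 < p.2 := hp.2.1
    -- Here `τ = τ₁ - ev`, bounded below by `t/2 - M H` through the eigenvalue bound.
    refine agmon_pointwise hM hH ht hj hj' (by linarith) (Real.exp_pos _) hW
      (fun hc => weight_le_exp hh ht (by positivity) hc) ?_ (sq_mul_weightDeriv_sq hh ht).le
    refine (Complex.abs_re_le_norm _).trans_eq ?_
    rw [norm_mul, RCLike.norm_conj]
  have hint := setIntegral_mono_on
    (((IG.const_mul (1 / 4)).add (IV.const_mul (H / 2))).sub (IN.const_mul ((M + 1) * W * H)))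
    ID hR hle
  -- The energy identity makes the right-hand side vanish.
  rw [hD] at hint
  erw [integral_sub ((IG.const_mul (1 / 4)).add (IV.const_mul (H / 2)))
    (IN.const_mul ((M + 1) * W * H)), integral_add (IG.const_mul (1 / 4)) (IV.const_mul (H / 2)),
    integral_const_mul, integral_const_mul, integral_const_mul] at hint
  have hG0 : 0 ≤ ∫ p in rect δ, weight (1 / 3) h p.2 * (h ^ 2 * (‖ψs p‖ ^ 2 + ‖ψt p‖ ^ 2)) :=
    integral_nonneg fun p => mul_nonneg (Real.exp_pos _).le (by positivity)
  have hV0 : 0 ≤ ∫ p in rect δ, weight (1 / 3) h p.2 * ‖ψ p‖ ^ 2 :=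
    integral_nonneg fun p => mul_nonneg (Real.exp_pos _).le (by positivity)
  have hN0 : 0 ≤ normSqM γ δ ψ := setIntegral_nonneg hR fun p hp =>
    mul_nonneg (by positivity) (by linarith [(hbd p hp).1])
  change 1 / 4 * _ + H / 2 * _ - (M + 1) * W * H * normSqM γ δ ψ ≤ 0 at hint
  have hC : 0 ≤ (M + 1) * W * normSqM γ δ ψ := by positivity
  refine ⟨⟨IV, ?_⟩, IG, ?_⟩
  · change ∫ p in rect δ, weight (1 / 3) h p.2 * ‖ψ p‖ ^ 2 ≤ _
    refine le_of_mul_le_mul_left ?_ hH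
    nlinarith [mul_nonneg hH.le hC]
  · change ∫ p in rect δ, weight (1 / 3) h p.2 * (h ^ 2 * (‖ψs p‖ ^ 2 + ‖ψt p‖ ^ 2)) ≤ _
    nlinarith [mul_nonneg hH.le hV0]
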